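/- Let $\mathbb{F}$ be a field of characteristic $0$. An associative interchange algebra over $\mathbb{F}$ is a vector space with two bilinear associative operations $\circ$ and $\bullet$ satisfying the interchange identity $(a \circ b) \bullet (c \circ d) = (a \bullet c) \circ (b \bullet d)$. Let $A$ be the free associative interchange algebra over $\mathbb{F}$ on countably many generators, with the two Lie brackets \[ [a,b]_\circ = a \circ b - b \circ a, \qquad [a,b]_\bullet = a \bullet b - b \bullet a . \] Let $n \le 5$, and let $f$ be a multilinear nonassociative polynomial of degree $n$ over $\mathbb{F}$ in two binary operation symbols, that is, a linear combination of nonassociative monomials in each of which every one of the indeterminates $x_1, \dots, x_n$ occurs exactly once and no other indeterminate occurs. Suppose that $f$ vanishes under every substitution of elements of $A$ for the indeterminates, when the two operation symbols are interpreted as $[-,-]_\circ$ and $[-,-]_\bullet$. Then $f$ is a consequence of anticommutativity $[a,b]_\ast + [b,a]_\ast \equiv 0$ and the Jacobi identity $[a,[b,c]_\ast]_\ast + [b,[c,a]_\ast]_\ast + [c,[a,b]_\ast]_\ast \equiv 0$ for $\ast \in \{\circ, \bullet\}$: it can be obtained from these identities by substituting nonassociative polynomials for the indeterminates, multiplying on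 either side by nonassociative polynomials using either operation symbol, and forming linear combinations. -/

import Mathlib

namespace Interchange

/-- The two binary operation symbols. -/
inductive Op : Type
  | circ
  | bullet

/-- Nonassociative monomials in the indeterminates `X` with two binary operation symbols. -/
inductive Monomial (X : Type*) : Type _
  | var (x : X) : Monomial X
  | op (o : Op) (s t : Monomial X) : Monomial X

/-- The underlying sequence of indeterminates of a monomial. -/
def Monomial.vars {X : Type*} : Monomial X → List X
  | .var x => [x]
  | .op _ s t => s.vars ++ t.vars

/-- The value of a monomial in a space `A` with two bilinear operations `mul`. -/
def Monomial.eval {F A X : Type*} [Field F] [AddCommGroup A] [Module F A]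
    (mul : Op → A →ₗ[F] A →ₗ[F] A) (v : X → A) : Monomial X → A
  | .var x => v x
  | .op o s t => mul o (s.eval mul v) (t.eval mul v)

/-- The underlying space of the free algebra with two bilinear operations: the monomials
form a basis. -/
abbrev Poly (F X : Type*) [Field F] : Type _ := Monomial X →₀ F

namespace Poly

noncomputable section

variable {F X : Type*} [Field F]

/-- The indeterminate `x` as a polynomial. -/
def var (x : X) : Poly F X := Finsupp.single (Monomial.var x) 1

/-- The two operations of the free algebra: the bilinear extensions of
`(s, t) ↦ Monomial.op o s t`. -/
def mul (o : Op) : Poly F X →ₗ[F] Poly F X →ₗ[F] Poly F X :=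
  Finsupp.linearCombination F fun s => Finsupp.lmapDomain F F (Monomial.op o s)

/-- Evaluation of polynomials in a space `A` with two bilinear operations. -/
def eval {A : Type*} [AddCommGroup A] [Module F A]
    (mul : Op → A →ₗ[F] A →ₗ[F] A) (v : X → A) : Poly F X →ₗ[F] A :=
  Finsupp.linearCombination F (Monomial.eval mul v)

/-- A multilinear polynomial of degree `n`: in each monomial, each of the indeterminates
`0, 1, …, n - 1` occurs exactly once, and no other indeterminate occurs. -/
def IsMultilinear (n : ℕ) (f : Poly F ℕ) : Prop :=
  ∀ m ∈ f.support, m.vars.Perm (List.range n)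

end

end Poly

/-- `f` is a polynomial identity of the space `A` with the two bilinear operations `mul`:
every substitution of elements of `A` for the indeterminates gives `0`. -/
def IsIdentity {F A X : Type*} [Field F] [AddCommGroup A] [Module F A]
    (mul : Op → A →ₗ[F] A →ₗ[F] A) (f : Poly F X) : Prop :=
  ∀ v : X → A, Poly.eval mul v f = 0

/-- `f` is a consequence of the identities in `S`: it is obtained from elements of `S` by
substituting polynomials for the indeterminates, multiplying by polynomials on either side,
and forming linear combinations. -/
inductive IsConsequence {F X : Type*} [Field F] (S : Set (Poly F ℕ)) : Poly F X → Prop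
  | subst (g : Poly F ℕ) (hg : g ∈ S) (φ : ℕ → Poly F X) :
      IsConsequence S (Poly.eval Poly.mul φ g)
  | zero : IsConsequence S 0
  | add (f g : Poly F X) : IsConsequence S f → IsConsequence S g → IsConsequence S (f + g)
  | smul (c : F) (f : Poly F X) : IsConsequence S f → IsConsequence S (c • f)
  | mul_left (o : Op) (a f : Poly F X) : IsConsequence S f → IsConsequence S (Poly.mul o a f)
  | mul_right (o : Op) (f a : Poly F X) : IsConsequence S f → IsConsequence S (Poly.mul o f a)

noncomputable section

/-- The ideal of all consequences of `S` in the indeterminates `X`. -/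
def consequences {F : Type*} [Field F] (S : Set (Poly F ℕ)) (X : Type*) :
    Submodule F (Poly F X) where
  carrier := {f | IsConsequence S f}
  zero_mem' := .zero
  add_mem' := fun {f g} hf hg => .add f g hf hg
  smul_mem' := fun c f hf => .smul c f hf

/-- The free algebra on `X` in the variety defined by the identities in `S`. -/
abbrev FreeAlg {F : Type*} [Field F] (S : Set (Poly F ℕ)) (X : Type*) : Type _ :=
  Poly F X ⧸ consequences S X

/-- The two operations of the free algebra, induced by those on polynomials. -/
def FreeAlg.mul {F : Type*} [Field F] (S : Set (Poly F ℕ)) (X : Type*) (o : Op) :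
    FreeAlg S X →ₗ[F] FreeAlg S X →ₗ[F] FreeAlg S X :=
  (consequences S X).liftQ
    ((consequences S X).liftQ ((Poly.mul o).compr₂ (consequences S X).mkQ).flip
      (fun f hf => LinearMap.ext fun a => (Submodule.Quotient.mk_eq_zero (consequences S X)).2
        (IsConsequence.mul_left o a f hf))).flip
    (fun f hf => LinearMap.ext fun b => by
      obtain ⟨a, rfl⟩ := Submodule.Quotient.mk_surjective _ b
      exact (Submodule.Quotient.mk_eq_zero (consequences S X)).2
        (IsConsequence.mul_right o f a hf))

/-- `(x₀ * x₁) * x₂ - x₀ * (x₁ * x₂)` for the operation `o`. -/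
def associativity (F : Type*) [Field F] (o : Op) : Poly F ℕ :=
  Poly.mul o (Poly.mul o (Poly.var 0) (Poly.var 1)) (Poly.var 2) -
    Poly.mul o (Poly.var 0) (Poly.mul o (Poly.var 1) (Poly.var 2))

/-- `(x₀ ∘ x₁) • (x₂ ∘ x₃) - (x₀ • x₂) ∘ (x₁ • x₃)`. -/
def interchange (F : Type*) [Field F] : Poly F ℕ :=
  Poly.mul .bullet (Poly.mul .circ (Poly.var 0) (Poly.var 1))
      (Poly.mul .circ (Poly.var 2) (Poly.var 3)) -
    Poly.mul .circ (Poly.mul .bullet (Poly.var 0) (Poly.var 2))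
      (Poly.mul .bullet (Poly.var 1) (Poly.var 3))

/-- The defining identities of associative interchange algebras. -/
def assocInterchangeIdentities (F : Type*) [Field F] : Set (Poly F ℕ) :=
  {associativity F .circ, associativity F .bullet, interchange F}

/-- The free associative interchange algebra on `X`. -/
abbrev FreeAssocInterchange (F X : Type*) [Field F] : Type _ :=
  FreeAlg (assocInterchangeIdentities F) X

/-- The commutator brackets `[a, b]_o = a o b - b o a` of two bilinear operations. -/
def bracket {F A : Type*} [Field F] [AddCommGroup A] [Module F A]
    (mul : Op → A →ₗ[F] A →ₗ[F] A) (o : Op) : A →ₗ[F] A →ₗ[F] A :=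
  mul o - (mul o).flip

/-- The two Lie brackets of the free associative interchange algebra on `X`. -/
def lieBracket (F X : Type*) [Field F] :
    Op → FreeAssocInterchange F X →ₗ[F] FreeAssocInterchange F X →ₗ[F]
      FreeAssocInterchange F X :=
  bracket (FreeAlg.mul (assocInterchangeIdentities F) X)

/-- `[x₀, x₁] + [x₁, x₀]` for the operation `o`. -/
def anticommutativity (F : Type*) [Field F] (o : Op) : Poly F ℕ :=
  Poly.mul o (Poly.var 0) (Poly.var 1) + Poly.mul o (Poly.var 1) (Poly.var 0)

/-- `[x₀, [x₁, x₂]] + [x₁, [x₂, x₀]] + [x₂, [x₀, x₁]]` for the operation `o`. -/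
def jacobi (F : Type*) [Field F] (o : Op) : Poly F ℕ :=
  Poly.mul o (Poly.var 0) (Poly.mul o (Poly.var 1) (Poly.var 2)) +
    Poly.mul o (Poly.var 1) (Poly.mul o (Poly.var 2) (Poly.var 0)) +
    Poly.mul o (Poly.var 2) (Poly.mul o (Poly.var 0) (Poly.var 1))

/-- Anticommutativity and the Jacobi identity for each of the two operations. -/
def lieIdentities (F : Type*) [Field F] : Set (Poly F ℕ) :=
  {anticommutativity F .circ, anticommutativity F .bullet, jacobi F .circ, jacobi F .bullet}

end

end Interchange

/-!
In the free algebra with two associative operations, a multilinear Lie polynomial can be recovered,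
modulo anticommutativity and the Jacobi identities, from its expansion: it is enough to read off the
coefficients of the monomials in which, at every vertex, the last factor contains the least
indeterminate. An identity of the brackets in the free associative interchange algebra therefore
follows from the Lie identities as soon as its expansion is zero.

The interchange identity only affects monomials in which some product has two adjacent factors that
are themselves products, so all other coefficients of the expansion vanish. Replacing `a • b` by
`-(b • a)` does not change the brackets, but changes the sign of one side of the interchange
identity. Hence every linear relation `x + y = 0` between coefficients which comes from the
interchange identity also holds as `x - y = 0`, so that `x = y = 0` where `2 ≠ 0`. In degree five,
one family of coefficients is only known to satisfy such a relation in sums of two terms; it is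
killed by combining this relation with the antisymmetries of expansions of Lie polynomials.
-/

namespace Interchange

noncomputable section

instance : DecidableEq Op
  | .circ, .circ | .bullet, .bullet => isTrue rfl
  | .circ, .bullet | .bullet, .circ => isFalse nofun

theorem Op.eq_or_eq_of_ne {o o' : Op} (h : o' ≠ o) (o₁ : Op) : o₁ = o ∨ o₁ = o' := by
  cases o <;> cases o' <;> cases o₁ <;> simp_all

theorem Op.eq_and_eq_or_of_ne {o o' p p' : Op} (h : o' ≠ o) (h' : p' ≠ p) :
    p = o ∧ p' = o' ∨ p = o' ∧ p' = o := by
  cases o <;> cases o' <;> cases p <;> cases p' <;> simp_all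

theorem Op.eq_of_ne_of_ne {o o₁ o₂ : Op} (h₁ : o₁ ≠ o) (h₂ : o₂ ≠ o) : o₁ = o₂ :=
  ((Op.eq_or_eq_of_ne h₁ o₂).resolve_left h₂).symm

/-! ### Evaluation of polynomials -/

namespace Poly

variable {F X A : Type*} [Field F] [AddCommGroup A] [Module F A]
  (m : Op → A →ₗ[F] A →ₗ[F] A) (v : X → A)

@[simp]
theorem mul_single (o : Op) (s t : Monomial X) (a b : F) :
    mul o (Finsupp.single s a) (Finsupp.single t b) = Finsupp.single (.op o s t) (a * b) := by
  simp [mul, Finsupp.linearCombination_single, -Finsupp.single_mul]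

@[simp]
theorem eval_single (s : Monomial X) (a : F) :
    eval m v (Finsupp.single s a) = a • s.eval m v := by
  simp [eval, Finsupp.linearCombination_single]

@[simp]
theorem eval_var (x : X) : eval m v (var x) = v x := by
  simp [var, Monomial.eval]

@[simp]
theorem eval_mul (o : Op) (f g : Poly F X) :
    eval m v (mul o f g) = m o (eval m v f) (eval m v g) := by
  have h : (mul o).compr₂ (eval m v) = (m o).compl₁₂ (eval m v) (eval m v) := by
    ext s t
    simp [Monomial.eval]
  exact LinearMap.congr_fun₂ h f g

theorem map_eval {B : Type*} [AddCommGroup B] [Module F B] (m' : Op → B →ₗ[F] B →ₗ[F] B)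
    (h : A →ₗ[F] B) (hh : ∀ o a b, h (m o a b) = m' o (h a) (h b)) (f : Poly F X) :
    h (eval m v f) = eval m' (h ∘ v) f := by
  have map_monomial_eval (s : Monomial X) : h (s.eval m v) = s.eval m' (h ∘ v) := by
    induction s with
    | var x => rfl
    | op o s t hs ht => simp only [Monomial.eval, hh, hs, ht]
  have h' : h ∘ₗ eval m v = eval m' (h ∘ v) := by
    ext s
    simp [map_monomial_eval]
  exact LinearMap.congr_fun h' f

theorem eval_eval {Y : Type*} (φ : Y → Poly F X) (g : Poly F Y) :
    eval m v (eval mul φ g) = eval m (eval m v ∘ φ) g :=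
  map_eval (A := Poly F X) (B := A) mul φ m (eval m v) (eval_mul m v) g

theorem eval_mul_var (f : Poly F X) : eval mul var f = f := by
  have monomial_eval (s : Monomial X) :
      s.eval mul (var : X → Poly F X) = Finsupp.single s 1 := by
    induction s with
    | var x => rfl
    | op o s t hs ht => simp [Monomial.eval, hs, ht]
  have h : eval mul (var : X → Poly F X) = LinearMap.id := by
    refine Finsupp.lhom_ext fun s a => ?_
    simp [monomial_eval]
  exact LinearMap.congr_fun h f

end Poly

/-! ### Interchange ideals -/

section InterchangeIdeal

variable {F X A : Type*} [Field F] [AddCommGroup A] [Module F A]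
  {m : Op → A →ₗ[F] A →ₗ[F] A} {ε : F} {I : Submodule F A}

theorem bracket_apply (o : Op) (a b : A) : bracket m o a b = m o a b - m o b a := rfl

theorem bracket_swap (o : Op) (a b : A) : bracket m o a b = -bracket m o b a :=
  (neg_sub _ _).symm

/-- `I` is an ideal modulo which both operations are associative and satisfy
`(a ∘ b) • (c ∘ d) = ε (a • c) ∘ (b • d)`. -/
structure IsInterchangeIdeal (m : Op → A →ₗ[F] A →ₗ[F] A) (ε : F) (I : Submodule F A) :
    Prop where
  mul_left : ∀ o a, ∀ b ∈ I, m o a b ∈ I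
  mul_right : ∀ o, ∀ a ∈ I, ∀ b, m o a b ∈ I
  assoc : ∀ o a b c, m o (m o a b) c - m o a (m o b c) ∈ I
  interchange : ∀ a b c d, m .bullet (m .circ a b) (m .circ c d) -
    ε • m .circ (m .bullet a c) (m .bullet b d) ∈ I

theorem IsInterchangeIdeal.eval_mem (h : IsInterchangeIdeal m 1 I) (v : X → A) {f : Poly F X}
    (hf : IsConsequence (assocInterchangeIdentities F) f) : Poly.eval m v f ∈ I := by
  induction hf with
  | subst g hg φ =>
    rw [Poly.eval_eval]
    rcases hg with rfl | rfl | rfl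
    · simpa [associativity] using h.assoc ..
    · simpa [associativity] using h.assoc ..
    · simpa [Interchange.interchange] using h.interchange ..
  | zero => simp
  | add f g _ _ hf hg => simpa using add_mem hf hg
  | smul c f _ hf => simpa using I.smul_mem c hf
  | mul_left o a f _ hf => simpa using h.mul_left o _ _ hf
  | mul_right o f a _ hf => simpa using h.mul_right o _ hf _

theorem IsInterchangeIdeal.eval_bracket_mem_of_one (h : IsInterchangeIdeal m 1 I) (v : X → A)
    {f : Poly F X} (hid : IsIdentity (lieBracket F X) f) : Poly.eval (bracket m) v f ∈ I := by
  set S := assocInterchangeIdentities F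
  have mkQ_eval : (consequences S X).mkQ (Poly.eval (bracket Poly.mul) Poly.var f) = 0 := by
    rw [Poly.map_eval _ _ (lieBracket F X) _ fun o a b => map_sub (consequences S X).mkQ _ _]
    exact hid _
  have isConsequence : IsConsequence S (Poly.eval (bracket Poly.mul) Poly.var f) :=
    (Submodule.Quotient.mk_eq_zero _).1 mkQ_eval
  have eval_eval_bracket := Poly.map_eval (bracket Poly.mul) Poly.var (bracket m)
    (Poly.eval m v) (fun o a b => by simp [bracket_apply]) f
  rw [show Poly.eval m v ∘ Poly.var = v from funext (Poly.eval_var m v)] at eval_eval_bracket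
  exact eval_eval_bracket ▸ h.eval_mem v isConsequence

/-- The operations `a ∘ b` and `- b • a`. They have the same commutator brackets as `m`, but the
interchange identity changes its sign. -/
def twist (m : Op → A →ₗ[F] A →ₗ[F] A) : Op → A →ₗ[F] A →ₗ[F] A
  | .circ => m .circ
  | .bullet => -(m .bullet).flip

theorem bracket_twist : bracket (twist m) = bracket m := by
  funext o
  cases o
  · rfl
  · ext a b
    simp [bracket_apply, twist, neg_add_eq_sub]

theorem IsInterchangeIdeal.twist (h : IsInterchangeIdeal m ε I) :
    IsInterchangeIdeal (twist m) (-ε) I where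
  mul_left
    | .circ => h.mul_left .circ
    | .bullet => fun a b hb => neg_mem (h.mul_right .bullet b hb a)
  mul_right
    | .circ => h.mul_right .circ
    | .bullet => fun a ha b => neg_mem (h.mul_left .bullet b a ha)
  assoc
    | .circ => h.assoc .circ
    | .bullet => fun a b c => by
      simpa [Interchange.twist] using neg_mem (h.assoc .bullet c b a)
  interchange a b c d := by
    simpa [Interchange.twist, ← sub_eq_add_neg, neg_add_eq_sub] using
      neg_mem (h.interchange c d a b)

theorem IsInterchangeIdeal.eval_bracket_mem (h : IsInterchangeIdeal m ε I) (hε : ε ^ 2 = 1)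
    (v : X → A) {f : Poly F X} (hid : IsIdentity (lieBracket F X) f) :
    Poly.eval (bracket m) v f ∈ I := by
  rcases sq_eq_one_iff.1 hε with rfl | rfl
  · exact h.eval_bracket_mem_of_one v hid
  · rw [← bracket_twist]
    exact (neg_neg (1 : F) ▸ h.twist).eval_bracket_mem_of_one v hid

end InterchangeIdeal

/-! ### Monomials modulo associativity -/

namespace Monomial

variable {X : Type*}

/-- The outermost operation symbol of a monomial is `o`. -/
def Rooted (o : Op) : Monomial X → Prop
  | .var _ => False
  | .op o' _ _ => o' = o

@[simp]
theorem not_rooted_var (o : Op) (x : X) : ¬ (var x).Rooted o := id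

@[simp]
theorem rooted_op_iff {o o' : Op} {s t : Monomial X} : (op o' s t).Rooted o ↔ o' = o := .rfl

/-- Reduced monomials are those in which both operations are associated to the right. They
represent the monomials modulo associativity. -/
def Reduced : Monomial X → Prop
  | .var _ => True
  | .op o s t => s.Reduced ∧ t.Reduced ∧ ¬ s.Rooted o

/-- The product of monomials modulo associativity: on reduced monomials it is the reduced form of
`Monomial.op o u w`. -/
def join (o : Op) : Monomial X → Monomial X → Monomial X
  | .var x, w => .op o (.var x) w
  | .op o' s t, w => if o' = o then .op o s (join o t w) else .op o (.op o' s t) w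

theorem join_of_not_rooted {o : Op} {u : Monomial X} (hu : ¬ u.Rooted o) (w : Monomial X) :
    join o u w = .op o u w := by
  cases u with
  | var x => rfl
  | op o' s t => exact if_neg hu

@[simp]
theorem join_op_self (o : Op) (s t w : Monomial X) :
    join o (.op o s t) w = .op o s (join o t w) := if_pos rfl

@[elab_as_elim]
theorem factor_induction {P : Monomial X → Prop} (o : Op)
    (of_not_rooted : ∀ u, ¬ u.Rooted o → P u)
    (op_self : ∀ s t, P t → P (.op o s t)) (u : Monomial X) : P u := by
  induction u with
  | var x => exact of_not_rooted _ id
  | op o' s t _ ht =>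
    by_cases h : o' = o
    · exact h ▸ op_self s t ht
    · exact of_not_rooted _ h

theorem rooted_join (o o' : Op) (u w : Monomial X) : (join o u w).Rooted o' ↔ o = o' := by
  cases u with
  | var x => rfl
  | op o₁ s t => unfold join; split_ifs <;> rfl

theorem join_assoc (o : Op) (u v w : Monomial X) :
    join o (join o u v) w = join o u (join o v w) := by
  induction u using factor_induction o with
  | of_not_rooted u hu => simp only [join_of_not_rooted hu, join_op_self]
  | op_self s t ht => simp only [join_op_self, ht]

theorem length_vars_join (o : Op) (u w : Monomial X) :
    (join o u w).vars.length = u.vars.length + w.vars.length := by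
  induction u using factor_induction o with
  | of_not_rooted u hu => simp [join_of_not_rooted hu, vars]
  | op_self s t ht => simp [vars, ht, add_assoc]

theorem Reduced.join {o : Op} {u w : Monomial X} (hu : u.Reduced) (hw : w.Reduced) :
    (join o u w).Reduced := by
  induction u using factor_induction o with
  | of_not_rooted u h => exact join_of_not_rooted h w ▸ ⟨hu, hw, h⟩
  | op_self s t ht => exact join_op_self o s t w ▸ ⟨hu.1, ht hu.2.1, hu.2.2⟩

theorem join_eq_op_iff {o : Op} {x : Monomial X} (hx : ¬ x.Rooted o) (u w y : Monomial X) :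
    join o u w = .op o x y ↔
      (u = x ∧ w = y) ∨ ∃ u', u = .op o x u' ∧ join o u' w = y := by
  induction u using factor_induction o with
  | of_not_rooted u hu =>
    rw [join_of_not_rooted hu, or_iff_left]
    · simp only [op.injEq, true_and]
    · rintro ⟨u', rfl, -⟩
      exact hu rfl
  | op_self s t _ =>
    rw [join_op_self, or_iff_right]
    · simp only [op.injEq, true_and]
      exact ⟨fun ⟨hs, ht⟩ => ⟨t, ⟨hs, rfl⟩, ht⟩, fun ⟨_, ⟨hs, ht⟩, h⟩ => ⟨hs, ht ▸ h⟩⟩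
    · rintro ⟨rfl, -⟩
      exact hx rfl

theorem join_eq_op_iff_of_not_rooted {o : Op} {x y : Monomial X} (hx : ¬ x.Rooted o)
    (hy : ¬ y.Rooted o) (u w : Monomial X) : join o u w = .op o x y ↔ u = x ∧ w = y := by
  rw [join_eq_op_iff hx, or_iff_left]
  rintro ⟨u', -, rfl⟩
  exact hy ((rooted_join o o u' w).2 rfl)

theorem join_eq_op_op_iff {o : Op} {x y z : Monomial X} (hx : ¬ x.Rooted o)
    (hy : ¬ y.Rooted o) (hz : ¬ z.Rooted o) (u w : Monomial X) :
    join o u w = .op o x (.op o y z) ↔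
      (u = x ∧ w = .op o y z) ∨ (u = .op o x y ∧ w = z) := by
  simp [join_eq_op_iff hx, join_eq_op_iff_of_not_rooted hy hz]

end Monomial

namespace Poly

variable {F X M : Type*} [Field F] [AddCommGroup M] [Module F M] {o : Op}

/-- The product of polynomials modulo associativity: the bilinear extension of
`Monomial.join o`. -/
def joinMul (o : Op) : Poly F X →ₗ[F] Poly F X →ₗ[F] Poly F X :=
  Finsupp.linearCombination F fun s => Finsupp.lmapDomain F F (Monomial.join o s)

@[simp]
theorem joinMul_single (o : Op) (s t : Monomial X) (a b : F) :
    joinMul o (Finsupp.single s a) (Finsupp.single t b) =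
      Finsupp.single (Monomial.join o s t) (a * b) := by
  simp [joinMul, Finsupp.linearCombination_single, -Finsupp.single_mul]

theorem joinMul_assoc (o : Op) (f g h : Poly F X) :
    joinMul o (joinMul o f g) h = joinMul o f (joinMul o g h) := by
  have key : (joinMul o).compr₂ (joinMul o) =
      (LinearMap.llcomp F (Poly F X) (Poly F X) (Poly F X)).compl₁₂ (joinMul o) (joinMul o) := by
    ext s t u : 6
    simp [Monomial.join_assoc]
  exact LinearMap.congr_fun (LinearMap.congr_fun₂ key f g) h

theorem bilin_mem_of_mem_supported (B : Poly F X →ₗ[F] Poly F X →ₗ[F] M) {N : Submodule F M}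
    {s t : Set (Monomial X)}
    (h : ∀ x ∈ s, ∀ y ∈ t, B (Finsupp.single x 1) (Finsupp.single y 1) ∈ N)
    {f g : Poly F X} (hf : f ∈ Finsupp.supported F F s) (hg : g ∈ Finsupp.supported F F t) :
    B f g ∈ N := by
  rw [Finsupp.supported_eq_span_single] at hf hg
  have hB := Submodule.apply_mem_map₂ B hf hg
  rw [Submodule.map₂_span_span] at hB
  refine Submodule.span_le.2 ?_ hB
  rintro _ ⟨_, ⟨x, hx, rfl⟩, _, ⟨y, hy, rfl⟩, rfl⟩
  exact h x hx y hy

theorem joinMul_mem_supported {f g : Poly F X} {s t u : Set (Monomial X)}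
    (h : ∀ x ∈ s, ∀ y ∈ t, Monomial.join o x y ∈ u)
    (hf : f ∈ Finsupp.supported F F s) (hg : g ∈ Finsupp.supported F F t) :
    joinMul o f g ∈ Finsupp.supported F F u :=
  bilin_mem_of_mem_supported (joinMul o)
    (fun x hx y hy => by simpa using Finsupp.single_mem_supported F (1 : F) (h x hx y hy)) hf hg

theorem joinMul_apply_of_not_rooted {T : Monomial X} (hT : ¬ T.Rooted o) (f g : Poly F X) :
    joinMul o f g T = 0 := by
  classical
  have h : (joinMul o).compr₂ (Finsupp.lapply T) = (0 : Poly F X →ₗ[F] Poly F X →ₗ[F] F) := by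
    ext s t
    have hst : Monomial.join o s t ≠ T := fun h => hT (h ▸ (Monomial.rooted_join ..).2 rfl)
    simp [hst]
  exact LinearMap.congr_fun₂ h f g

theorem joinMul_apply_op {x y : Monomial X} (hx : ¬ x.Rooted o) (hy : ¬ y.Rooted o)
    (f g : Poly F X) : joinMul o f g (.op o x y) = f x * g y := by
  classical
  have h : (joinMul o).compr₂ (Finsupp.lapply (.op o x y)) =
      (LinearMap.mul F F).compl₁₂ (Finsupp.lapply x) (Finsupp.lapply y) := by
    ext s t
    simp [Finsupp.single_apply, Monomial.join_eq_op_iff_of_not_rooted hx hy, ← ite_and, and_comm]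
  exact LinearMap.congr_fun₂ h f g

theorem joinMul_apply_op_op {x y z : Monomial X} (hx : ¬ x.Rooted o) (hy : ¬ y.Rooted o)
    (hz : ¬ z.Rooted o) (f g : Poly F X) :
    joinMul o f g (.op o x (.op o y z)) = f x * g (.op o y z) + f (.op o x y) * g z := by
  classical
  have h : (joinMul o).compr₂ (Finsupp.lapply (.op o x (.op o y z))) =
      (LinearMap.mul F F).compl₁₂ (Finsupp.lapply x) (Finsupp.lapply (.op o y z)) +
        (LinearMap.mul F F).compl₁₂ (Finsupp.lapply (.op o x y)) (Finsupp.lapply z) := by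
    ext s t
    have hxy : Monomial.op o x y ≠ x := fun h => hx (h ▸ rfl)
    by_cases hs : s = x
    · simp [Finsupp.single_apply, Monomial.join_eq_op_op_iff hx hy hz, hs, hxy.symm]
    · simp [Finsupp.single_apply, Monomial.join_eq_op_op_iff hx hy hz, hs, ← ite_and, and_comm]
  exact LinearMap.congr_fun₂ h f g

end Poly

/-! ### Expansion of Lie polynomials -/

section Expand

variable {F X : Type*} [Field F]

variable (F) in
/-- The expansion of a Lie monomial, with both operations read as commutator brackets, in the free
algebra with two associative operations. -/
def Monomial.expand (m : Monomial X) : Poly F X :=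
  m.eval (bracket Poly.joinMul) Poly.var

/-- The linear extension of `Monomial.expand`. -/
def expand : Poly F X →ₗ[F] Poly F X := Poly.eval (bracket Poly.joinMul) Poly.var

theorem bracket_joinMul_mem_supported {o : Op} {s t u : Set (Monomial X)} {f g : Poly F X}
    (h : ∀ x ∈ s, ∀ y ∈ t, Monomial.join o x y ∈ u ∧ Monomial.join o y x ∈ u)
    (hf : f ∈ Finsupp.supported F F s) (hg : g ∈ Finsupp.supported F F t) :
    bracket Poly.joinMul o f g ∈ Finsupp.supported F F u := by
  rw [bracket_apply]
  exact sub_mem (Poly.joinMul_mem_supported (fun x hx y hy => (h x hx y hy).1) hf hg)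
    (Poly.joinMul_mem_supported (fun y hy x hx => (h x hx y hy).2) hg hf)

theorem Monomial.expand_mem_supported (m : Monomial X) : m.expand F ∈
    Finsupp.supported F F {T : Monomial X | T.Reduced ∧ T.vars.length = m.vars.length} := by
  induction m with
  | var x => exact Finsupp.single_mem_supported F _ ⟨trivial, rfl⟩
  | op o s t hs ht =>
    refine bracket_joinMul_mem_supported (fun x hx y hy => ⟨⟨hx.1.join hy.1, ?_⟩,
      ⟨hy.1.join hx.1, ?_⟩⟩) hs ht
    · simp [length_vars_join, hx.2, hy.2, vars]
    · simp [length_vars_join, hx.2, hy.2, vars, add_comm]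

theorem expand_mem_supported {n : ℕ} {f : Poly F X}
    (hf : ∀ m ∈ f.support, m.vars.length ≤ n) :
    expand f ∈ Finsupp.supported F F {T : Monomial X | T.Reduced ∧ T.vars.length ≤ n} := by
  rw [expand, Poly.eval, Finsupp.linearCombination_apply]
  refine Submodule.sum_mem _ fun m hm => Submodule.smul_mem _ _ ?_
  exact Finsupp.supported_mono (fun T hT => And.intro hT.1 (hT.2.trans_le (hf m hm)))
    m.expand_mem_supported

end Expand

/-! ### Recovering a Lie polynomial from its expansion -/

section Recover

/-- Both operations are anticommutative and satisfy the Jacobi identity, in the form in which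
`br o a` is a derivation of `br o`. The stronger identity `[a, a] = 0` is not required. -/
structure IsLie {F A : Type*} [Field F] [AddCommGroup A] [Module F A]
    (br : Op → A →ₗ[F] A →ₗ[F] A) : Prop where
  swap : ∀ o a b, br o a b = -br o b a
  leibniz : ∀ o a b c, br o (br o a b) c = br o a (br o b c) - br o b (br o a c)

theorem FreeAlg.isIdentity {F X : Type*} [Field F] {S : Set (Poly F ℕ)} {g : Poly F ℕ}
    (hg : g ∈ S) : IsIdentity (FreeAlg.mul S X) g := by
  intro v
  choose φ hφ using fun i => Submodule.mkQ_surjective _ (v i)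
  calc Poly.eval (FreeAlg.mul S X) v g
      = (consequences S X).mkQ (Poly.eval Poly.mul φ g) := by
        rw [Poly.map_eval (A := Poly F X) Poly.mul φ (FreeAlg.mul S X) (consequences S X).mkQ
          (fun _ _ _ => rfl), ← funext hφ]
        rfl
    _ = 0 := (Submodule.Quotient.mk_eq_zero _).2 (.subst g hg φ)

theorem isLie_freeAlg (F X : Type*) [Field F] : IsLie (FreeAlg.mul (lieIdentities F) X) := by
  have swap : ∀ o a b, FreeAlg.mul (lieIdentities F) X o a b =
      -FreeAlg.mul (lieIdentities F) X o b a := by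
    intro o a b
    have h : anticommutativity F o ∈ lieIdentities F := by cases o <;> simp [lieIdentities]
    have := FreeAlg.isIdentity (X := X) h (fun i => if i = 0 then a else b)
    simpa [anticommutativity, add_eq_zero_iff_eq_neg] using this
  refine ⟨swap, fun o a b c => ?_⟩
  have h : jacobi F o ∈ lieIdentities F := by cases o <;> simp [lieIdentities]
  have := FreeAlg.isIdentity (X := X) h (fun i => if i = 0 then a else if i = 1 then b else c)
  simp only [jacobi, map_add, Poly.eval_mul, Poly.eval_var] at this
  simp only [one_ne_zero, OfNat.ofNat_ne_zero, OfNat.ofNat_ne_one, if_true, if_false] at this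
  rw [swap o c a, swap o c (FreeAlg.mul _ _ o a b), map_neg] at this
  rw [← sub_eq_zero, ← neg_eq_zero, ← this]
  abel

variable {F X A : Type*} [Field F] [LinearOrder X] [AddCommGroup A] [Module F A]

namespace Monomial

/-- The least indeterminate of a monomial. -/
def minVar : Monomial X → X
  | .var x => x
  | .op _ s t => min s.minVar t.minVar

theorem minVar_mem_vars (m : Monomial X) : m.minVar ∈ m.vars := by
  induction m with
  | var x => simp [minVar, vars]
  | op o s t hs ht =>
    rcases min_choice s.minVar t.minVar with h | h <;> simp [minVar, vars, h, hs, ht]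

theorem minVar_join (o : Op) (u w : Monomial X) :
    (join o u w).minVar = min u.minVar w.minVar := by
  induction u using factor_induction o with
  | of_not_rooted u hu => rw [join_of_not_rooted hu, minVar]
  | op_self s t ht => simp only [join_op_self, minVar, ht, min_assoc]

/-- The Lie monomial with bracketing `m` if at every vertex the last factor contains the least
indeterminate, and `0` otherwise. -/
def recover (br : Op → A →ₗ[F] A →ₗ[F] A) (v : X → A) : Monomial X → A
  | .var x => v x
  | .op o s t => if t.minVar < s.minVar then br o (s.recover br v) (t.recover br v) else 0

theorem recover_join_eq_zero (br : Op → A →ₗ[F] A →ₗ[F] A) (v : X → A) (o : Op)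
    {u w : Monomial X} (h : u.minVar < w.minVar) : (join o u w).recover br v = 0 := by
  induction u using factor_induction o with
  | of_not_rooted u hu => rw [join_of_not_rooted hu, recover, if_neg h.not_gt]
  | op_self s t ht =>
    rw [join_op_self, recover, minVar_join]
    rcases lt_or_ge t.minVar w.minVar with htw | hwt
    · rw [ht htw, map_zero, ite_self]
    · rw [min_eq_right hwt, if_neg]
      exact ((min_lt_iff.1 h).resolve_right hwt.not_gt).not_gt

end Monomial

/-- The linear extension of `Monomial.recover`. -/
def recover (br : Op → A →ₗ[F] A →ₗ[F] A) (v : X → A) : Poly F X →ₗ[F] A :=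
  Finsupp.linearCombination F (Monomial.recover br v)

/-- `p` behaves like the expansion of a Lie polynomial with least indeterminate `k` and value `a`:
as long as the last factor contains the least indeterminate, `recover` is multiplicative for
left multiplication by `p`. -/
structure Represents (br : Op → A →ₗ[F] A →ₗ[F] A) (v : X → A) (k : X) (p : Poly F X) (a : A) :
    Prop where
  minVar_eq : p ∈ Finsupp.supported F F {T : Monomial X | T.minVar = k}
  recover_eq : recover br v p = a
  recover_joinMul : ∀ o, ∀ g ∈ Finsupp.supported F F {T : Monomial X | T.minVar < k},
    recover br v (Poly.joinMul o p g) = br o a (recover br v g)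

variable {br : Op → A →ₗ[F] A →ₗ[F] A} {v : X → A} {k l : X} {o : Op} {p q g : Poly F X}
  {a b : A}

theorem recover_joinMul_eq_zero
    (hp : p ∈ Finsupp.supported F F {T : Monomial X | T.minVar = k})
    (hg : g ∈ Finsupp.supported F F {T : Monomial X | k < T.minVar}) :
    recover br v (Poly.joinMul o p g) = 0 := by
  refine Poly.bilin_mem_of_mem_supported ((Poly.joinMul o).compr₂ (recover br v)) (N := ⊥)
    (fun x hx y hy => ?_) hp hg
  have hxy : x.minVar < y.minVar := hx.out ▸ hy
  simp [recover, Monomial.recover_join_eq_zero br v o hxy]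

theorem recover_joinMul_of_not_rooted
    (hp : p ∈ Finsupp.supported F F {T : Monomial X | T.minVar = k ∧ ¬ T.Rooted o})
    (hg : g ∈ Finsupp.supported F F {T : Monomial X | T.minVar < k}) :
    recover br v (Poly.joinMul o p g) = br o (recover br v p) (recover br v g) := by
  refine sub_eq_zero.1 (Poly.bilin_mem_of_mem_supported (N := ⊥)
    ((Poly.joinMul o).compr₂ (recover br v) - (br o).compl₁₂ (recover br v) (recover br v))
    (fun x hx y hy => ?_) hp hg)
  have hxy : y.minVar < x.minVar := hx.1 ▸ hy
  simp [recover, Monomial.join_of_not_rooted hx.2, Monomial.recover, hxy]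

namespace Represents

theorem var (br : Op → A →ₗ[F] A →ₗ[F] A) (v : X → A) (x : X) :
    Represents br v x (Poly.var x) (v x) := by
  have recover_var : recover br v (Poly.var x) = v x := by
    simp [recover, Poly.var, Monomial.recover]
  refine ⟨Finsupp.single_mem_supported F _ rfl, recover_var, fun o g hg => ?_⟩
  rw [← recover_var]
  exact recover_joinMul_of_not_rooted (Finsupp.single_mem_supported F _ ⟨rfl, id⟩) hg

theorem neg (hp : Represents br v k p a) : Represents br v k (-p) (-a) where
  minVar_eq := neg_mem hp.minVar_eq
  recover_eq := by rw [map_neg, hp.recover_eq]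
  recover_joinMul o g hg := by simp [hp.recover_joinMul o g hg]

theorem joinMul_minVar_lt (hp : Represents br v k p a)
    (hg : g ∈ Finsupp.supported F F {T : Monomial X | T.minVar < l}) (o : Op) :
    Poly.joinMul o p g ∈ Finsupp.supported F F {T : Monomial X | T.minVar < l} :=
  Poly.joinMul_mem_supported
    (fun x _ y hy => (Monomial.minVar_join o x y).trans_lt (min_lt_of_right_lt hy))
    hp.minVar_eq hg

theorem bracket_of_lt (hbr : IsLie br) (hp : Represents br v k p a) (hq : Represents br v l q b)
    (hlk : l < k) (o : Op) :
    Represents br v l (bracket Poly.joinMul o p q) (br o a b) := by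
  have hql : q ∈ Finsupp.supported F F {T : Monomial X | T.minVar < k} :=
    Finsupp.supported_mono (fun T hT => hT.out.trans_lt hlk) hq.minVar_eq
  have minVar_eq_and_rooted : bracket Poly.joinMul o p q ∈
      Finsupp.supported F F {T : Monomial X | T.minVar = l ∧ T.Rooted o} := by
    refine bracket_joinMul_mem_supported (fun x hx y hy => ?_) hp.minVar_eq hq.minVar_eq
    rw [Set.mem_ofPred_eq] at hx hy
    simp [Monomial.rooted_join, Monomial.minVar_join, hx, hy, hlk.le]
  have recover_bracket : recover br v (bracket Poly.joinMul o p q) = br o a b := by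
    rw [bracket_apply, map_sub, hp.recover_joinMul o q hql, hq.recover_eq,
      recover_joinMul_eq_zero hq.minVar_eq, sub_zero]
    exact Finsupp.supported_mono (fun T hT => hlk.trans_eq hT.out.symm) hp.minVar_eq
  refine ⟨Finsupp.supported_mono (fun T hT => hT.1) minVar_eq_and_rooted, recover_bracket,
    fun o' g hgl => ?_⟩
  by_cases ho : o' = o
  · subst ho
    have hgk : g ∈ Finsupp.supported F F {T : Monomial X | T.minVar < k} :=
      Finsupp.supported_mono (fun T hT => hT.out.trans hlk) hgl
    calc recover br v (Poly.joinMul o' (bracket Poly.joinMul o' p q) g)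
        = recover br v (Poly.joinMul o' p (Poly.joinMul o' q g)) -
            recover br v (Poly.joinMul o' q (Poly.joinMul o' p g)) := by
          simp only [bracket_apply, map_sub, LinearMap.sub_apply, Poly.joinMul_assoc]
      _ = br o' a (br o' b (recover br v g)) - br o' b (br o' a (recover br v g)) := by
          rw [hp.recover_joinMul o' _ (hq.joinMul_minVar_lt hgk o'),
            hq.recover_joinMul o' _ (hp.joinMul_minVar_lt hgl o'),
            hq.recover_joinMul o' g hgl, hp.recover_joinMul o' g hgk]
      _ = br o' (br o' a b) (recover br v g) := (hbr.leibniz ..).symm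
  · rw [← recover_bracket]
    refine recover_joinMul_of_not_rooted (Finsupp.supported_mono ?_ minVar_eq_and_rooted) hgl
    rintro (x | ⟨o₁, s, t⟩) ⟨hT, hTo⟩
    exacts [⟨hT, id⟩, ⟨hT, fun h => ho (h.symm.trans hTo)⟩]

theorem bracket (hbr : IsLie br) (hp : Represents br v k p a) (hq : Represents br v l q b)
    (hkl : k ≠ l) (o : Op) :
    Represents br v (min k l) (Interchange.bracket Poly.joinMul o p q) (br o a b) := by
  rcases hkl.lt_or_gt with h | h
  · rw [min_eq_left h.le, hbr.swap, bracket_swap]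
    exact (bracket_of_lt hbr hq hp h o).neg
  · rw [min_eq_right h.le]
    exact bracket_of_lt hbr hp hq h o

end Represents

theorem Monomial.represents_expand (hbr : IsLie br) (v : X → A) {m : Monomial X}
    (hm : m.vars.Nodup) : Represents br v m.minVar (m.expand F) (m.eval br v) := by
  induction m with
  | var x => exact .var br v x
  | op o s t hs ht =>
    obtain ⟨nodup_s, nodup_t, disjoint⟩ := List.nodup_append.1 hm
    exact (hs nodup_s).bracket hbr (ht nodup_t)
      (disjoint _ s.minVar_mem_vars _ t.minVar_mem_vars) o

theorem recover_expand (hbr : IsLie br) (v : X → A) {f : Poly F X}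
    (hf : ∀ m ∈ f.support, m.vars.Nodup) : recover br v (expand f) = Poly.eval br v f := by
  rw [expand, Poly.eval, Poly.eval, Finsupp.linearCombination_apply,
    Finsupp.linearCombination_apply, map_finsuppSum]
  refine Finsupp.sum_congr fun m hm => ?_
  rw [map_smul, ← (m.represents_expand hbr v (hf m hm)).recover_eq, Monomial.expand]

theorem isConsequence_of_expand_eq_zero {f : Poly F X} (hf : ∀ m ∈ f.support, m.vars.Nodup)
    (h : expand f = 0) : IsConsequence (lieIdentities F) f := by
  refine (Submodule.Quotient.mk_eq_zero (consequences (lieIdentities F) X)).1 ?_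
  calc (consequences (lieIdentities F) X).mkQ f
      = (consequences (lieIdentities F) X).mkQ (Poly.eval Poly.mul Poly.var f) := by
        rw [Poly.eval_mul_var]
    _ = Poly.eval (FreeAlg.mul (lieIdentities F) X) _ f :=
        Poly.map_eval _ _ _ (consequences (lieIdentities F) X).mkQ (fun _ _ _ => rfl) f
    _ = recover (FreeAlg.mul (lieIdentities F) X) _ (expand f) :=
        (recover_expand (isLie_freeAlg F X) _ hf).symm
    _ = 0 := by rw [h, map_zero]

end Recover

/-! ### Monomials to which the interchange identity applies -/

namespace Monomial

variable {X : Type*}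

/-- The monomial is not an indeterminate. -/
def IsProduct : Monomial X → Prop
  | .var _ => False
  | .op _ _ _ => True

/-- In a reduced monomial, the first factor with respect to the operation `o` is not an
indeterminate. -/
def HeadIsProduct (o : Op) : Monomial X → Prop
  | .var _ => False
  | .op o' s _ => o' = o → s.IsProduct

/-- In a reduced monomial, some product has two adjacent factors that are not indeterminates. Only
to such monomials can the interchange identity be applied. -/
def Crowded : Monomial X → Prop
  | .var _ => False
  | .op o s t => s.Crowded ∨ t.Crowded ∨ (s.IsProduct ∧ t.HeadIsProduct o)

theorem HeadIsProduct.join {o : Op} {u : Monomial X} (hu : u.HeadIsProduct o)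
    (w : Monomial X) : (join o u w).HeadIsProduct o := by
  induction u using factor_induction o with
  | of_not_rooted u h =>
    cases u with
    | var x => exact hu.elim
    | op o' s t => exact join_of_not_rooted h w ▸ fun _ => trivial
  | op_self s t _ => exact join_op_self o s t w ▸ hu

theorem Crowded.join_left (o : Op) {u : Monomial X} (hu : u.Crowded) (w : Monomial X) :
    (join o u w).Crowded := by
  induction u using factor_induction o with
  | of_not_rooted u h => exact join_of_not_rooted h w ▸ .inl hu
  | op_self s t ht =>
    rw [join_op_self]
    exact hu.imp_right (Or.imp ht (And.imp_right (HeadIsProduct.join · w)))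

theorem Crowded.join_right (o : Op) (u : Monomial X) {w : Monomial X} (hw : w.Crowded) :
    (join o u w).Crowded := by
  induction u using factor_induction o with
  | of_not_rooted u h => exact join_of_not_rooted h w ▸ .inr (.inl hw)
  | op_self s t ht => exact join_op_self o s t w ▸ .inr (.inl ht)

theorem crowded_join {o o' : Op} (h : o' ≠ o) {u w : Monomial X} (hu : u.Rooted o')
    (hw : w.Rooted o') : (join o u w).Crowded := by
  cases u with
  | var x => exact hu.elim
  | op o₁ s t =>
    cases w with
    | var x => exact hw.elim
    | op o₂ s' t' =>
      rw [join_of_not_rooted (rooted_op_iff.not.2 fun ho => h (hu.symm.trans ho))]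
      exact .inr (.inr ⟨trivial, fun ho => (h (hw.symm.trans ho)).elim⟩)

/-- The monomial `(a o' b) o (c o' d)`. -/
abbrev square (o o' : Op) (a b c d : Monomial X) : Monomial X :=
  .op o (.op o' a b) (.op o' c d)

end Monomial

section Relations

open Monomial

variable {F X : Type*} [Field F] {ε : F}

variable (F X) in
/-- The span of the crowded monomials. -/
def crowdedSpan : Submodule F (Poly F X) :=
  Finsupp.supported F F {T : Monomial X | T.Crowded}

theorem crowdedSpan_joinMul_left (o : Op) {p : Poly F X} (hp : p ∈ crowdedSpan F X)
    (q : Poly F X) : Poly.joinMul o p q ∈ crowdedSpan F X :=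
  Poly.joinMul_mem_supported (t := Set.univ) (fun _ hx y _ => Crowded.join_left o hx y) hp
    (by simp [Finsupp.supported_univ])

theorem crowdedSpan_joinMul_right (o : Op) (p : Poly F X) {q : Poly F X}
    (hq : q ∈ crowdedSpan F X) : Poly.joinMul o p q ∈ crowdedSpan F X :=
  Poly.joinMul_mem_supported (s := Set.univ) (fun x _ _ hy => Crowded.join_right o x hy)
    (by simp [Finsupp.supported_univ]) hq

theorem joinMul_joinMul_mem_crowdedSpan {o o' : Op} (h : o' ≠ o) (a b c d : Poly F X) :
    Poly.joinMul o (Poly.joinMul o' a b) (Poly.joinMul o' c d) ∈ crowdedSpan F X := by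
  have rooted (a b : Poly F X) :
      Poly.joinMul o' a b ∈ Finsupp.supported F F {T : Monomial X | T.Rooted o'} :=
    Poly.joinMul_mem_supported (s := Set.univ) (t := Set.univ)
      (fun x _ y _ => (rooted_join o' o' x y).2 rfl)
      (by simp [Finsupp.supported_univ]) (by simp [Finsupp.supported_univ])
  exact Poly.joinMul_mem_supported (fun _ hx _ hy => crowded_join h hx hy)
    (rooted a b) (rooted c d)

/-- Linear relations that the coefficients of the elements of the ideal generated by the
differences of the two sides of the interchange identity satisfy in degree at most five, when the
right-hand side is multiplied by `ε`. In `column`, the two last monomials come from the two ways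
of splitting `a o' b o' c` into two factors. -/
structure InterchangeRelations (ε : F) (p : Poly F X) : Prop where
  mem_crowdedSpan : p ∈ crowdedSpan F X
  degree_four : ∀ {o o' : Op}, o' ≠ o → ∀ a b c d : X,
    p (square o o' (.var a) (.var b) (.var c) (.var d)) +
      ε * p (square o' o (.var a) (.var c) (.var b) (.var d)) = 0
  row_left : ∀ {o o' : Op}, o' ≠ o → ∀ a b c d e : X,
    p (.op o (.op o' (.var a) (.var b)) (.op o (.op o' (.var c) (.var d)) (.var e))) +
      ε * p (.op o (square o' o (.var a) (.var c) (.var b) (.var d)) (.var e)) = 0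
  row_right : ∀ {o o' : Op}, o' ≠ o → ∀ a b c d e : X,
    p (.op o (.var e) (square o o' (.var a) (.var b) (.var c) (.var d))) +
      ε * p (.op o (.var e) (square o' o (.var a) (.var c) (.var b) (.var d))) = 0
  column : ∀ {o o' : Op}, o' ≠ o → ∀ a b c d e : X,
    p (square o o' (.var a) (.op o' (.var b) (.var c)) (.var d) (.var e)) +
      ε * (p (square o' o (.var a) (.var d) (.op o' (.var b) (.var c)) (.var e)) +
        p (square o' o (.op o' (.var a) (.var b)) (.var d) (.var c) (.var e))) = 0

variable (F X) in
/-- The polynomials that satisfy `InterchangeRelations`. -/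
def relationSubmodule (ε : F) : Submodule F (Poly F X) where
  carrier := {p | InterchangeRelations ε p}
  zero_mem' := ⟨zero_mem _, by simp, by simp, by simp, by simp⟩
  add_mem' {p q} hp hq := by
    refine ⟨add_mem hp.mem_crowdedSpan hq.mem_crowdedSpan, fun ho a b c d => ?_,
      fun ho a b c d e => ?_, fun ho a b c d e => ?_, fun ho a b c d e => ?_⟩ <;>
    simp only [Finsupp.add_apply]
    · linear_combination hp.degree_four ho a b c d + hq.degree_four ho a b c d
    · linear_combination hp.row_left ho a b c d e + hq.row_left ho a b c d e
    · linear_combination hp.row_right ho a b c d e + hq.row_right ho a b c d e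
    · linear_combination hp.column ho a b c d e + hq.column ho a b c d e
  smul_mem' r p hp := by
    refine ⟨Submodule.smul_mem _ r hp.mem_crowdedSpan, fun ho a b c d => ?_,
      fun ho a b c d e => ?_, fun ho a b c d e => ?_, fun ho a b c d e => ?_⟩ <;>
    simp only [Finsupp.smul_apply, smul_eq_mul]
    · linear_combination r * hp.degree_four ho a b c d
    · linear_combination r * hp.row_left ho a b c d e
    · linear_combination r * hp.row_right ho a b c d e
    · linear_combination r * hp.column ho a b c d e

namespace InterchangeRelations

variable {p : Poly F X}

theorem apply_eq_zero (hp : InterchangeRelations ε p) {T : Monomial X} (hT : ¬ T.Crowded) :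
    p T = 0 :=
  (Finsupp.mem_supported' F p).1 hp.mem_crowdedSpan T hT

theorem joinMul_left (hp : InterchangeRelations ε p) (o₁ : Op) (q : Poly F X) :
    InterchangeRelations ε (Poly.joinMul o₁ p q) := by
  have apply_eq_zero {T : Monomial X} (hT : ¬ T.Crowded) : p T = 0 := hp.apply_eq_zero hT
  have apply_var (x : X) : p (.var x) = 0 := apply_eq_zero id
  refine ⟨crowdedSpan_joinMul_left o₁ hp.mem_crowdedSpan q, fun {_ _} ho a b c d => ?_,
    fun {_ _} ho a b c d e => ?row_left, fun {_ _} ho a b c d e => ?_,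
    fun {_ _} ho a b c d e => ?_⟩ <;>
  rcases Op.eq_or_eq_of_ne ho o₁ with rfl | rfl
  case row_left.inl =>
    rw [Poly.joinMul_apply_op_op (by simp [ho]) (by simp [ho]) (by simp),
      Poly.joinMul_apply_op (by simp [ho]) (by simp),
      apply_eq_zero (by simp [Crowded, IsProduct]), zero_mul, zero_add]
    linear_combination q (.var e) * hp.degree_four ho a b c d
  all_goals
    simp [Poly.joinMul_apply_op, Poly.joinMul_apply_op_op, Poly.joinMul_apply_of_not_rooted,
      ho, ho.symm, apply_var, apply_eq_zero, Crowded, IsProduct, HeadIsProduct]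

theorem joinMul_right (hp : InterchangeRelations ε p) (o₁ : Op) (q : Poly F X) :
    InterchangeRelations ε (Poly.joinMul o₁ q p) := by
  have apply_eq_zero {T : Monomial X} (hT : ¬ T.Crowded) : p T = 0 := hp.apply_eq_zero hT
  have apply_var (x : X) : p (.var x) = 0 := apply_eq_zero id
  refine ⟨crowdedSpan_joinMul_right o₁ q hp.mem_crowdedSpan, fun {_ _} ho a b c d => ?_,
    fun {_ _} ho a b c d e => ?_, fun {_ _} ho a b c d e => ?row_right,
    fun {_ _} ho a b c d e => ?_⟩ <;>
  rcases Op.eq_or_eq_of_ne ho o₁ with rfl | rfl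
  case row_right.inl =>
    rw [Poly.joinMul_apply_op_op (by simp) (by simp [ho]) (by simp [ho]),
      Poly.joinMul_apply_op (by simp) (by simp [ho]),
      apply_eq_zero (T := .op _ (.var c) (.var d)) (by simp [Crowded, HeadIsProduct, IsProduct]),
      mul_zero, add_zero]
    linear_combination q (.var e) * hp.degree_four ho a b c d
  all_goals
    simp [Poly.joinMul_apply_op, Poly.joinMul_apply_op_op, Poly.joinMul_apply_of_not_rooted,
      ho, ho.symm, apply_var, apply_eq_zero, Crowded, IsProduct, HeadIsProduct]

end InterchangeRelations

theorem interchangeRelations_sub_smul {o o' : Op} (ho : o' ≠ o) (hε : ε ^ 2 = 1)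
    (f g h k : Poly F X) : InterchangeRelations ε
      (Poly.joinMul o (Poly.joinMul o' f g) (Poly.joinMul o' h k) -
        ε • Poly.joinMul o' (Poly.joinMul o f h) (Poly.joinMul o g k)) := by
  refine ⟨sub_mem (joinMul_joinMul_mem_crowdedSpan ho ..)
    (Submodule.smul_mem _ _ (joinMul_joinMul_mem_crowdedSpan ho.symm ..)),
    fun {o₁ _} ho₁ a b c d => ?degree_four, fun {o₁ _} ho₁ a b c d e => ?row_left,
    fun {o₁ _} ho₁ a b c d e => ?row_right, fun {o₁ _} ho₁ a b c d e => ?column⟩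
  all_goals
    obtain ⟨rfl, rfl⟩ | ⟨rfl, rfl⟩ := Op.eq_and_eq_or_of_ne ho ho₁
    all_goals
      simp only [Finsupp.sub_apply, Finsupp.smul_apply, smul_eq_mul, Poly.joinMul_apply_op,
        Poly.joinMul_apply_op_op, Poly.joinMul_apply_of_not_rooted, rooted_op_iff,
        not_rooted_var, ho, ho.symm, not_false_eq_true]
  case degree_four.inl =>
    linear_combination
      -(f (.var a) * g (.var b) * h (.var c) * k (.var d)) * hε
  case column.inl =>
    linear_combination
      -(f (.var a) * g (.op _ (.var b) (.var c)) + f (.op _ (.var a) (.var b)) * g (.var c)) *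
        (h (.var d) * k (.var e)) * hε
  all_goals ring

theorem isInterchangeIdeal_relationSubmodule (hε : ε ^ 2 = 1) :
    IsInterchangeIdeal Poly.joinMul ε (relationSubmodule F X ε) where
  mul_left o a b hb := hb.joinMul_right o a
  mul_right o a ha b := ha.joinMul_left o b
  assoc o a b c := by simp [Poly.joinMul_assoc]
  interchange := interchangeRelations_sub_smul (by simp) hε

theorem interchangeRelations_expand (hε : ε ^ 2 = 1) {f : Poly F X}
    (hid : IsIdentity (lieBracket F X) f) : InterchangeRelations ε (expand f) :=
  (isInterchangeIdeal_relationSubmodule hε).eval_bracket_mem hε Poly.var hid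

end Relations

/-! ### Vanishing of the crowded coefficients -/

section Antisymmetry

variable {F X : Type*} [Field F] {o : Op} {x y : Monomial X}

theorem Monomial.expand_apply_op (hx : ¬ x.Rooted o) (hy : ¬ y.Rooted o) (s t : Monomial X) :
    (op o s t).expand F (op o x y) =
      s.expand F x * t.expand F y - t.expand F x * s.expand F y := by
  simp only [expand, eval, bracket_apply, Finsupp.sub_apply, Poly.joinMul_apply_op hx hy]

theorem Monomial.expand_apply_of_not_rooted {m : Monomial X} (hm : ¬ m.Rooted o) :
    m.expand F (op o x y) = 0 := by
  cases m with
  | var z => simp [expand, eval, Poly.var]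
  | op o' s t =>
    have not_rooted : ¬ (op o x y).Rooted o' := fun h => hm h.symm
    simp only [expand, eval, bracket_apply, Finsupp.sub_apply,
      Poly.joinMul_apply_of_not_rooted not_rooted, sub_zero]

variable (F) in
/-- The coefficients of `T` and `T'` in the expansion of any Lie monomial are opposite. -/
def HasOppositeCoeffs (T T' : Monomial X) : Prop :=
  ∀ m : Monomial X, m.expand F T' = -m.expand F T

namespace HasOppositeCoeffs

theorem expand_apply {T T' : Monomial X} (h : HasOppositeCoeffs F T T') (f : Poly F X) :
    expand f T' = -expand f T := by
  have key : Finsupp.lapply T' ∘ₗ expand = -(Finsupp.lapply T ∘ₗ (expand (F := F))) := by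
    ext m
    simpa [expand, Monomial.expand] using h m
  exact LinearMap.congr_fun key f

theorem op_swap (hx : ¬ x.Rooted o) (hy : ¬ y.Rooted o) :
    HasOppositeCoeffs F (.op o x y) (.op o y x) := by
  intro m
  by_cases hm : m.Rooted o
  · cases m with
    | var z => exact hm.elim
    | op o' s t =>
      obtain rfl : o' = o := hm
      rw [Monomial.expand_apply_op hx hy, Monomial.expand_apply_op hy hx]
      ring
  · simp only [Monomial.expand_apply_of_not_rooted hm, neg_zero]

theorem op_left {x' : Monomial X} (h : HasOppositeCoeffs F x x') (hx : ¬ x.Rooted o)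
    (hx' : ¬ x'.Rooted o) (hy : ¬ y.Rooted o) :
    HasOppositeCoeffs F (.op o x y) (.op o x' y) := by
  intro m
  by_cases hm : m.Rooted o
  · cases m with
    | var z => exact hm.elim
    | op o' s t =>
      obtain rfl : o' = o := hm
      rw [Monomial.expand_apply_op hx hy, Monomial.expand_apply_op hx' hy, h s, h t]
      ring
  · simp only [Monomial.expand_apply_of_not_rooted hm, neg_zero]

end HasOppositeCoeffs

end Antisymmetry

section Vanishing

open Monomial

variable {F : Type*} [Field F] [NeZero (2 : F)]

theorem eq_zero_of_forall_add_mul_eq_zero {x y : F}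
    (h : ∀ ε : F, ε ^ 2 = 1 → x + ε * y = 0) : x = 0 ∧ y = 0 := by
  have hadd := h 1 (one_pow 2)
  have hsub := h (-1) (by ring)
  constructor
  · apply mul_left_cancel₀ (two_ne_zero (α := F))
    linear_combination hadd + hsub
  · apply mul_left_cancel₀ (two_ne_zero (α := F))
    linear_combination hadd - hsub

theorem eq_zero_of_symmetries {α : Type*} (H : α → α → α → α → α → F)
    (neg : ∀ a b c d e, H d b c a e = -H a b c d e)
    (cycle : ∀ a b c d e, H c a b e d = H a b c d e) (a b c d e : α) : H a b c d e = 0 := by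
  -- The cube of `cycle` is the transposition `(4 5)`. Conjugating it by `neg`, which is `(1 4)`,
  -- gives `(1 5)`, and conjugating this by `(4 5)` gives back `(1 4)`, now without a sign.
  have swap₄₅ (a b c d e : α) : H a b c e d = H a b c d e :=
    (cycle b c a d e).trans ((cycle c a b e d).trans (cycle a b c d e))
  have swap₁₅ (a b c d e : α) : H e b c d a = H a b c d e := by
    rw [neg d b c e a, swap₄₅ d b c a e, neg a b c d e, neg_neg]
  have swap₁₄ : H d b c a e = H a b c d e := by
    rw [← swap₄₅ d b c a e, swap₁₅ a b c e d, swap₄₅]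
  apply mul_left_cancel₀ (two_ne_zero (α := F))
  linear_combination neg a b c d e - swap₁₄

variable {X : Type*} {f : Poly F X} {o o' : Op}

theorem expand_apply_square (hid : IsIdentity (lieBracket F X) f) (ho : o' ≠ o) (a b c d : X) :
    expand f (square o o' (.var a) (.var b) (.var c) (.var d)) = 0 :=
  (eq_zero_of_forall_add_mul_eq_zero fun _ hε =>
    (interchangeRelations_expand hε hid).degree_four ho a b c d).1

theorem expand_apply_row_left (hid : IsIdentity (lieBracket F X) f) (ho : o' ≠ o)
    (a b c d e : X) :
    expand f (.op o (.op o' (.var a) (.var b)) (.op o (.op o' (.var c) (.var d)) (.var e))) = 0 ∧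
      expand f (.op o (square o' o (.var a) (.var c) (.var b) (.var d)) (.var e)) = 0 :=
  eq_zero_of_forall_add_mul_eq_zero fun _ hε =>
    (interchangeRelations_expand hε hid).row_left ho a b c d e

theorem expand_apply_row_right (hid : IsIdentity (lieBracket F X) f) (ho : o' ≠ o)
    (a b c d e : X) :
    expand f (.op o (.var e) (square o o' (.var a) (.var b) (.var c) (.var d))) = 0 ∧
      expand f (.op o (.var e) (square o' o (.var a) (.var c) (.var b) (.var d))) = 0 :=
  eq_zero_of_forall_add_mul_eq_zero fun _ hε =>
    (interchangeRelations_expand hε hid).row_right ho a b c d e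

theorem expand_apply_column (hid : IsIdentity (lieBracket F X) f) (ho : o' ≠ o)
    (a b c d e : X) :
    expand f (square o o' (.var a) (.op o' (.var b) (.var c)) (.var d) (.var e)) = 0 ∧
      expand f (square o' o (.var a) (.var d) (.op o' (.var b) (.var c)) (.var e)) +
        expand f (square o' o (.op o' (.var a) (.var b)) (.var d) (.var c) (.var e)) = 0 :=
  eq_zero_of_forall_add_mul_eq_zero fun _ hε =>
    (interchangeRelations_expand hε hid).column ho a b c d e

theorem expand_apply_square_op (hid : IsIdentity (lieBracket F X) f) (ho : o' ≠ o)
    (a b c d e : X) :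
    expand f (square o o' (.var a) (.var b) (.op o (.var c) (.var d)) (.var e)) = 0 := by
  refine eq_zero_of_symmetries (fun a c d b e =>
    expand f (square o o' (.var a) (.var b) (.op o (.var c) (.var d)) (.var e)))
    (fun a c d b e => ?_) (fun a c d b e => ?_) a c d b e
  · have swap_inner : HasOppositeCoeffs F (.op o' (.var a) (.var b)) (.op o' (.var b) (.var a)) :=
      .op_swap (by simp) (by simp)
    exact (swap_inner.op_left (by simp [ho]) (by simp [ho]) (by simp [ho])).expand_apply f
  · have swap_outer : HasOppositeCoeffs F
        (square o o' (.var d) (.var e) (.op o (.var a) (.var c)) (.var b))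
        (square o o' (.op o (.var a) (.var c)) (.var b) (.var d) (.var e)) :=
      .op_swap (by simp [ho]) (by simp [ho])
    have h := (expand_apply_column hid ho.symm a c d b e).2
    rw [swap_outer.expand_apply, add_neg_eq_zero] at h
    exact h.symm

namespace Monomial

variable {m : Monomial X}

theorem one_le_length_vars (m : Monomial X) : 1 ≤ m.vars.length := by
  induction m with
  | var _ => exact le_rfl
  | op o s t hs _ => simpa only [vars, List.length_append] using le_add_right hs

theorem IsProduct.two_le_length_vars (hm : m.IsProduct) : 2 ≤ m.vars.length := by
  cases m with
  | var x => exact hm.elim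
  | op o s t => simpa [vars] using add_le_add s.one_le_length_vars t.one_le_length_vars

theorem HeadIsProduct.isProduct (hm : m.HeadIsProduct o) : m.IsProduct := by
  cases m with
  | var x => exact hm
  | op => trivial

theorem exists_eq_var (hm : m.vars.length ≤ 1) : ∃ x, m = .var x := by
  cases m with
  | var x => exact ⟨x, rfl⟩
  | op o s t =>
    have := IsProduct.two_le_length_vars (m := .op o s t) trivial
    lia

theorem IsProduct.exists_eq_op (hm : m.IsProduct) (hl : m.vars.length ≤ 2) :
    ∃ o x y, m = .op o (.var x) (.var y) := by
  cases m with
  | var x => exact hm.elim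
  | op o s t =>
    have hs := s.one_le_length_vars
    have ht := t.one_le_length_vars
    simp only [vars, List.length_append] at hl
    obtain ⟨x, rfl⟩ := s.exists_eq_var (by lia)
    obtain ⟨y, rfl⟩ := t.exists_eq_var (by lia)
    exact ⟨o, x, y, rfl⟩

theorem exists_eq_of_length_vars_add_eq_three {s t : Monomial X}
    (hl : s.vars.length + t.vars.length = 3) :
    (∃ x o y z, s = .var x ∧ t = .op o (.var y) (.var z)) ∨
      ∃ o x y z, s = .op o (.var x) (.var y) ∧ t = .var z := by
  cases s with
  | var x =>
    cases t with
    | var y => simp [vars] at hl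
    | op o t₁ t₂ =>
      obtain ⟨o, y, z, ht⟩ := IsProduct.exists_eq_op (m := .op o t₁ t₂) trivial
        (by simp only [vars, List.length_append, List.length_singleton] at hl ⊢; lia)
      exact .inl ⟨x, o, y, z, rfl, ht⟩
  | op o s₁ s₂ =>
    have hs := IsProduct.two_le_length_vars (m := .op o s₁ s₂) trivial
    obtain ⟨z, rfl⟩ := t.exists_eq_var (by lia)
    obtain ⟨o, x, y, hs⟩ := IsProduct.exists_eq_op (m := .op o s₁ s₂) trivial
      (by simp only [vars, List.length_append, List.length_singleton] at hl ⊢; lia)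
    exact .inr ⟨o, x, y, z, hs, rfl⟩

theorem Crowded.four_le_length_vars (hm : m.Crowded) : 4 ≤ m.vars.length := by
  induction m with
  | var x => exact hm.elim
  | op o s t hs ht =>
    simp only [vars, List.length_append]
    rcases hm with hs' | ht' | ⟨hs', ht'⟩
    · exact le_add_right (hs hs')
    · exact le_add_left (ht ht')
    · exact add_le_add hs'.two_le_length_vars ht'.isProduct.two_le_length_vars

theorem Crowded.exists_eq_square (hm : m.Crowded) (hr : m.Reduced) (hl : m.vars.length ≤ 4) :
    ∃ o o' a b c d, o' ≠ o ∧ m = square o o' (.var a) (.var b) (.var c) (.var d) := by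
  cases m with
  | var x => exact hm.elim
  | op o s t =>
    simp only [vars, List.length_append] at hl
    have hs := s.one_le_length_vars
    have ht := t.one_le_length_vars
    rcases hm with h | h | ⟨hs', ht'⟩
    · have := h.four_le_length_vars; lia
    · have := h.four_le_length_vars; lia
    · have hs₂ := hs'.two_le_length_vars
      have ht₂ := ht'.isProduct.two_le_length_vars
      obtain ⟨o₁, a, b, rfl⟩ := hs'.exists_eq_op (by lia)
      obtain ⟨o₂, c, d, rfl⟩ := ht'.isProduct.exists_eq_op (by lia)
      obtain rfl : o₂ = o₁ := Op.eq_of_ne_of_ne (fun h => ht' h) hr.2.2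
      exact ⟨o, o₂, a, b, c, d, hr.2.2, rfl⟩

end Monomial

theorem expand_apply_op_op_var_var (hid : IsIdentity (lieBracket F X) f) (ho : o' ≠ o)
    {s t : Monomial X} (hr : (op o' s t).Reduced) (hl : s.vars.length + t.vars.length = 3)
    (d e : X) : expand f (square o o' s t (.var d) (.var e)) = 0 := by
  have expand_apply_op_square (o₁ : Op) (h : o₁ ≠ o') (b c a : X) :
      expand f (square o o' (.op o₁ (.var b) (.var c)) (.var a) (.var d) (.var e)) = 0 := by
    obtain rfl : o₁ = o := Op.eq_of_ne_of_ne h ho.symm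
    have swap : HasOppositeCoeffs F
        (square o₁ o' (.var d) (.var e) (.op o₁ (.var b) (.var c)) (.var a))
        (square o₁ o' (.op o₁ (.var b) (.var c)) (.var a) (.var d) (.var e)) :=
      .op_swap (by simp [ho]) (by simp [ho])
    rw [swap.expand_apply, expand_apply_square_op hid ho, neg_zero]
  rcases exists_eq_of_length_vars_add_eq_three hl with
    ⟨a, o₁, b, c, rfl, rfl⟩ | ⟨o₁, b, c, a, rfl, rfl⟩
  · by_cases h : o₁ = o'
    · exact h ▸ (expand_apply_column hid ho a b c d e).1
    · have swap : HasOppositeCoeffs F (.op o' (.op o₁ (.var b) (.var c)) (.var a))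
          (.op o' (.var a) (.op o₁ (.var b) (.var c))) := .op_swap (by simp [h]) (by simp)
      rw [(swap.op_left (by simp [ho]) (by simp [ho]) (by simp [ho])).expand_apply,
        expand_apply_op_square o₁ h, neg_zero]
  · exact expand_apply_op_square o₁ hr.2.2 b c a

theorem expand_apply_op_of_isProduct (hid : IsIdentity (lieBracket F X) f) {s t : Monomial X}
    (hr : (op o s t).Reduced) (hl : s.vars.length + t.vars.length ≤ 5) (hs : s.IsProduct)
    (ht : t.IsProduct) (hto : ¬ t.Rooted o) : expand f (.op o s t) = 0 := by
  cases s with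
  | var x => exact hs.elim
  | op o' s₁ s₂ =>
    cases t with
    | var x => exact ht.elim
    | op o₁ t₁ t₂ =>
      have ho : o' ≠ o := hr.2.2
      obtain rfl : o₁ = o' := Op.eq_of_ne_of_ne hto ho
      have hs₁ := s₁.one_le_length_vars
      have hs₂ := s₂.one_le_length_vars
      have ht₁ := t₁.one_le_length_vars
      have ht₂ := t₂.one_le_length_vars
      simp only [vars, List.length_append] at hl
      by_cases hs3 : s₁.vars.length + s₂.vars.length = 3
      · obtain ⟨d, rfl⟩ := t₁.exists_eq_var (by lia)
        obtain ⟨e, rfl⟩ := t₂.exists_eq_var (by lia)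
        exact expand_apply_op_op_var_var hid ho hr.1 hs3 d e
      obtain ⟨d, rfl⟩ := s₁.exists_eq_var (by lia)
      obtain ⟨e, rfl⟩ := s₂.exists_eq_var (by lia)
      by_cases ht3 : t₁.vars.length + t₂.vars.length = 3
      · have swap : HasOppositeCoeffs F (square o o₁ t₁ t₂ (.var d) (.var e))
            (square o o₁ (.var d) (.var e) t₁ t₂) := .op_swap (by simp [ho]) (by simp [ho])
        rw [swap.expand_apply, expand_apply_op_op_var_var hid ho hr.2.1 ht3, neg_zero]
      obtain ⟨a, rfl⟩ := t₁.exists_eq_var (by lia)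
      obtain ⟨b, rfl⟩ := t₂.exists_eq_var (by lia)
      exact expand_apply_square hid ho d e a b

theorem expand_apply_op_op_of_isProduct (hid : IsIdentity (lieBracket F X) f)
    {s t u : Monomial X} (hr : (op o s (op o t u)).Reduced)
    (hl : s.vars.length + (t.vars.length + u.vars.length) ≤ 5)
    (hs : s.IsProduct) (ht : t.IsProduct) : expand f (.op o s (.op o t u)) = 0 := by
  have hs₂ := hs.two_le_length_vars
  have ht₂ := ht.two_le_length_vars
  have hu := u.one_le_length_vars
  obtain ⟨o', a, b, rfl⟩ := hs.exists_eq_op (by lia)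
  obtain ⟨o₁, c, d, rfl⟩ := ht.exists_eq_op (by lia)
  obtain ⟨e, rfl⟩ := u.exists_eq_var (by lia)
  obtain rfl : o₁ = o' := Op.eq_of_ne_of_ne hr.2.1.2.2 hr.2.2
  exact (expand_apply_row_left hid hr.2.2 a b c d e).1

theorem expand_apply_op_of_crowded_left (hid : IsIdentity (lieBracket F X) f) {s t : Monomial X}
    (hr : (op o s t).Reduced) (hl : s.vars.length + t.vars.length ≤ 5) (hs : s.Crowded) :
    expand f (.op o s t) = 0 := by
  have hs₄ := hs.four_le_length_vars
  have ht := t.one_le_length_vars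
  obtain ⟨e, rfl⟩ := t.exists_eq_var (by lia)
  obtain ⟨o', o₁, a, b, c, d, ho₁, rfl⟩ := hs.exists_eq_square hr.1 (by lia)
  have ho : o' ≠ o := hr.2.2
  obtain rfl : o₁ = o := Op.eq_of_ne_of_ne ho₁ ho.symm
  exact (expand_apply_row_left hid ho a c b d e).2

theorem expand_apply_op_of_crowded_right (hid : IsIdentity (lieBracket F X) f) {s t : Monomial X}
    (hr : t.Reduced) (hl : s.vars.length + t.vars.length ≤ 5) (ht : t.Crowded) :
    expand f (.op o s t) = 0 := by
  have ht₄ := ht.four_le_length_vars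
  have hs := s.one_le_length_vars
  obtain ⟨e, rfl⟩ := s.exists_eq_var (by lia)
  obtain ⟨o₁, o₂, a, b, c, d, ho, rfl⟩ := ht.exists_eq_square hr (by lia)
  by_cases h : o₁ = o
  · exact h ▸ (expand_apply_row_right hid ho a b c d e).1
  · obtain rfl : o₂ = o := Op.eq_of_ne_of_ne ho (Ne.symm h)
    exact (expand_apply_row_right hid h a c b d e).2

theorem expand_apply_of_crowded (hid : IsIdentity (lieBracket F X) f) {T : Monomial X}
    (hT : T.Crowded) (hr : T.Reduced) (hl : T.vars.length ≤ 5) : expand f T = 0 := by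
  cases T with
  | var x => exact hT.elim
  | op o s t =>
    simp only [vars, List.length_append] at hl
    rcases hT with hs | ht | ⟨hs, ht⟩
    · exact expand_apply_op_of_crowded_left hid hr hl hs
    · exact expand_apply_op_of_crowded_right hid hr.2.1 hl ht
    · by_cases hto : t.Rooted o
      · cases t with
        | var x => exact hto.elim
        | op o₁ t₁ t₂ =>
          obtain rfl : o₁ = o := hto
          simp only [vars, List.length_append] at hl
          exact expand_apply_op_op_of_isProduct hid hr hl hs (ht rfl)
      · exact expand_apply_op_of_isProduct hid hr hl hs ht.isProduct hto

theorem expand_eq_zero (hid : IsIdentity (lieBracket F X) f)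
    (hf : ∀ m ∈ f.support, m.vars.length ≤ 5) : expand f = 0 := by
  ext T
  by_cases hT : T.Reduced ∧ T.vars.length ≤ 5
  · by_cases crowded : T.Crowded
    · exact expand_apply_of_crowded hid crowded hT.1 hT.2
    · exact (interchangeRelations_expand (one_pow 2) hid).apply_eq_zero crowded
  · exact (Finsupp.mem_supported' F _).1 (expand_mem_supported hf) T hT

end Vanishing

end

end Interchange

theorem mainTheorem9_general {F X : Type*} [Field F] [NeZero (2 : F)] {f : Interchange.Poly F X}
    (hf : ∀ m ∈ f.support, m.vars.Nodup ∧ m.vars.length ≤ 5)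
    (hid : Interchange.IsIdentity (Interchange.lieBracket F X) f) :
    Interchange.IsConsequence (Interchange.lieIdentities F) f := by
  let _ : LinearOrder X := IsWellOrder.linearOrder WellOrderingRel
  exact Interchange.isConsequence_of_expand_eq_zero (fun m hm => (hf m hm).1)
    (Interchange.expand_eq_zero hid fun m hm => (hf m hm).2)

theorem mainTheorem9 {F : Type*} [Field F] [CharZero F] (n : ℕ) (hn : n ≤ 5)
    (f : Interchange.Poly F ℕ) (hf : f.IsMultilinear n)
    (hid : Interchange.IsIdentity (Interchange.lieBracket F ℕ) f) :
    Interchange.IsConsequence (Interchange.lieIdentities F) f :=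
  mainTheorem9_general (fun m hm => ⟨(hf m hm).nodup_iff.2 List.nodup_range,
    by simpa [(hf m hm).length_eq] using hn⟩) hid
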